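/- There is a universal constant $C>0$ such that the following holds for all integers $k\ge 2$ and $T\ge Ck$. There is a randomized assignment of rewards $g_i(t)\in[0,1]$ to the actions $i\in\{1,\dots,k\}$ in the rounds $t\in\{1,\dots,T\}$ of the following form. First, a switching time $t_0\in\{1,\dots,T\}$ and, for each of the two epochs $\{1,\dots,t_0\}$ and $\{t_0+1,\dots,T\}$ (the second is empty if $t_0=T$) and each action, a reward distribution supported on $[0,1]$ are chosen at random; in each epoch there is always a single good action, whose expected reward exceeds that of every other action by at least $\Delta=1/5$. Then, given these choices, all rewards are drawn independently, $g_i(t)$ from the distribution of action $i$ in the epoch that contains round $t$. For every (possibly randomized) standard bandit algorithm, that is, one which chooses the action $i_t$ in round $t$ as a function only of its internal randomness, independent of the rewards, and of the rewards $g_{i_1}(1),\dots,g_{i_{t-1}}(t-1)$ of the actions it chose before, the expected regret with respect to the best two-segment sequence of actions satisfies $$\mathbb{E}\left[\max_{0\le m\le T,\ i,j\in\{1,\dots,k\}}\left(\sum_{t=1}^{m}g_i(t)+\sum_{t=m+1}^{T}g_j(t)\right)-\sum_{t=1}^{T}g_{i_t}(t)\right]\ \ge\ 0.007\sqrt{(k-1)T},$$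 where the expectation is over the reward assignment and the randomness of the algorithm. -/

import Mathlib

open MeasureTheory

universe u

noncomputable section

namespace SwitchingBandit

/-- A reward table for `k` actions and `T` rounds: `g t i` is the reward of action `i` in round
`t`. Rounds are numbered from `0`, so `t : Fin T` is round number `t + 1`. -/
abbrev RewardTable (k T : ℕ) : Type := Fin T → Fin k → ℝ

/-- A stochastic reward environment with at most one change of the reward distributions. The first
epoch consists of the first `switch` rounds and the second epoch of the remaining ones (it is empty
when `switch = T`). In epoch `s`, the rewards of action `i` have law `arm s i`, a distribution
supported on `[0, 1]`. -/
structure Environment (k T : ℕ) where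
  switch : ℕ
  one_le_switch : 1 ≤ switch
  switch_le : switch ≤ T
  arm : Fin 2 → Fin k → Measure ℝ
  isProbabilityMeasure_arm : ∀ s i, IsProbabilityMeasure (arm s i)
  arm_support : ∀ s i, ∀ᵐ x ∂(arm s i), x ∈ Set.Icc (0 : ℝ) 1

namespace Environment

variable {k T : ℕ}

/-- The epoch that a round belongs to. -/
def epoch (e : Environment k T) (t : Fin T) : Fin 2 :=
  if (t : ℕ) < e.switch then 0 else 1

/-- The law of the reward table: all rewards are independent, and in round `t` the reward of action
`i` follows the law of action `i` in the epoch of `t`. -/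
def tableLaw (e : Environment k T) : Measure (RewardTable k T) :=
  Measure.pi fun t => Measure.pi fun i => e.arm (e.epoch t) i

/-- Expected reward of action `i` in epoch `s`. -/
def mean (e : Environment k T) (s : Fin 2) (i : Fin k) : ℝ :=
  ∫ x, x ∂(e.arm s i)

/-- `G` is a set of good actions for epoch `s` with gap `Δ`: the expected reward of any action in
`G` exceeds the expected reward of any action outside of `G` by at least `Δ`. -/
def IsGood (e : Environment k T) (s : Fin 2) (G : Finset (Fin k)) (Δ : ℝ) : Prop :=
  ∀ i ∈ G, ∀ j ∉ G, e.mean s j + Δ ≤ e.mean s i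

end Environment

/-- A randomized reward assignment: an environment is drawn from a finite family with a given
probability distribution, and then a reward table is drawn from it. -/
structure RandomAssignment (k T : ℕ) where
  Param : Type
  fintypeParam : Fintype Param
  prior : PMF Param
  env : Param → Environment k T

attribute [instance] RandomAssignment.fintypeParam

/-- The law of the reward table under a randomized reward assignment. -/
def RandomAssignment.tableLaw {k T : ℕ} (A : RandomAssignment k T) : Measure (RewardTable k T) :=
  ∑ θ, A.prior θ • (A.env θ).tableLaw

/-- A (possibly randomized) standard bandit algorithm for `k` actions and horizon `T`: in round `t`
it chooses an action as a function of its internal randomness (the seed) and of the rewards of the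
actions chosen in the previous rounds, which is all that it gets to see. -/
structure StandardBanditAlgorithm (k T : ℕ) where
  Seed : Type u
  measurableSpaceSeed : MeasurableSpace Seed
  seedLaw : Measure Seed
  isProbabilityMeasure_seedLaw : IsProbabilityMeasure seedLaw
  choice : (t : Fin T) → Seed → (Fin (t : ℕ) → ℝ) → Fin k
  measurable_choice : ∀ t : Fin T,
    Measurable fun p : Seed × (Fin (t : ℕ) → ℝ) => choice t p.1 p.2

attribute [instance] StandardBanditAlgorithm.measurableSpaceSeed
attribute [instance] StandardBanditAlgorithm.isProbabilityMeasure_seedLaw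

/-- The action chosen in round `t` with seed `ω` on the reward table `g`. -/
def StandardBanditAlgorithm.action {k T : ℕ} (alg : StandardBanditAlgorithm.{u} k T)
    (ω : alg.Seed) (g : RewardTable k T) (t : Fin T) : Fin k :=
  alg.choice t ω fun s : Fin (t : ℕ) =>
    g ⟨s, s.2.trans t.2⟩ (alg.action ω g ⟨s, s.2.trans t.2⟩)
  termination_by (t : ℕ)
  decreasing_by exact s.2

/-- Total reward of playing action `i` in the first `m` rounds and action `j` afterwards. -/
def twoSegmentReward {k T : ℕ} (g : RewardTable k T) (m : ℕ) (i j : Fin k) : ℝ :=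
  ∑ t : Fin T, if (t : ℕ) < m then g t i else g t j

/-- Regret of a sequence of actions with respect to the best two-segment sequence of actions. -/
def regret {k T : ℕ} (g : RewardTable k T) (a : Fin T → Fin k) : ℝ :=
  (⨆ c : Fin (T + 1) × Fin k × Fin k, twoSegmentReward g c.1 c.2.1 c.2.2) - ∑ t, g t (a t)

/-- Expected regret, over the seed of the algorithm and the (independent) reward assignment. -/
def expectedRegret {k T : ℕ} (A : RandomAssignment k T)
    (alg : StandardBanditAlgorithm.{u} k T) : ℝ :=
  ∫ p, regret p.2 (alg.action p.1 p.2) ∂(alg.seedLaw.prod A.tableLaw)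

end SwitchingBandit

end

/-! Detecting a late improvement requires exploration, and exploration is expensive when nothing
changes. Action `0` has mean 1/2 and the others 3/10. With probability 1/2 this never changes;
otherwise a uniformly random action other than `0` rises to 7/10 at the start of a uniformly random
one of `M` blocks of length `B`.

Fix the seed and let N be the expected number of choices other than `0` in the unchanged
environment. There the regret is at least N/5 (`regret_bernoulliEnv_none`). If action b improves at
a block and is not chosen in it, the loss is at least B/5. Until b is chosen after the switch, the
observations have the same law as without a change, so the probability of missing b can be computed
in the unchanged environment (`integral_avoids_eq`, `regret_bernoulliEnv_some`). One exploratory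
choice serves at most one pair (block, action), so over the M(k-1) pairs these probabilities sum to
at least M(k-1) - N (`sum_avoids_ge`).

Averaging, the terms in N have a nonnegative total coefficient once B ≤ M(k-1), which leaves regret
at least B/10 (`expectedRegret_blockAssignment`). As MB is about T, B can be taken of order
√((k-1)T) (`exists_blocks`). -/

namespace SwitchingBandit

/-! ### Measurability and causality of the actions -/

section Action

variable {k T : ℕ} (alg : StandardBanditAlgorithm.{u} k T)

theorem measurable_apply_index {α : Type*} [MeasurableSpace α] {x : α → Fin k → ℝ}
    {f : α → Fin k} (hx : Measurable x) (hf : Measurable f) : Measurable fun a => x a (f a) := by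
  have h : (fun a => x a (f a)) = fun a => ∑ i, if f a = i then x a i else 0 := by
    ext a; simp
  rw [h]
  refine Finset.measurable_sum _ fun i _ => Measurable.ite ?_ ?_ measurable_const
  · exact hf (measurableSet_singleton i)
  · exact (measurable_pi_apply i).comp hx

theorem measurable_action (t : Fin T) :
    Measurable fun p : alg.Seed × RewardTable k T => alg.action p.1 p.2 t := by
  obtain ⟨n, hn⟩ := t
  induction n using Nat.strong_induction_on with
  | _ n ih =>
    have h : (fun p : alg.Seed × RewardTable k T => alg.action p.1 p.2 ⟨n, hn⟩) =
        (fun q : alg.Seed × (Fin n → ℝ) => alg.choice ⟨n, hn⟩ q.1 q.2) ∘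
          fun p => (p.1, fun s : Fin n => p.2 ⟨s, s.2.trans hn⟩
            (alg.action p.1 p.2 ⟨s, s.2.trans hn⟩)) := by
      ext p : 1
      rw [StandardBanditAlgorithm.action]
      rfl
    rw [h]
    refine (alg.measurable_choice ⟨n, hn⟩).comp (measurable_fst.prodMk ?_)
    refine measurable_pi_lambda _ fun s => measurable_apply_index ?_ (ih s s.2 _)
    exact (measurable_pi_apply _).comp measurable_snd

/-- The action in round `t` depends only on the rewards obtained before round `t`. -/
theorem action_congr (ω : alg.Seed) {g g' : RewardTable k T} (t : Fin T)
    (h : ∀ s < t, g s (alg.action ω g s) = g' s (alg.action ω g s)) :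
    alg.action ω g t = alg.action ω g' t := by
  obtain ⟨n, hn⟩ := t
  induction n using Nat.strong_induction_on with
  | _ n ih =>
    rw [StandardBanditAlgorithm.action, StandardBanditAlgorithm.action]
    congr 1
    ext s
    have hs : (⟨s, s.2.trans hn⟩ : Fin T) < ⟨n, hn⟩ := s.2
    rw [← ih s s.2 (s.2.trans hn) fun r hr => h r (hr.trans hs)]
    exact h _ hs

end Action

/-! ### Rewards within a fixed environment -/

namespace Environment

variable {k T : ℕ} (e : Environment k T)

instance (s : Fin 2) (i : Fin k) : IsProbabilityMeasure (e.arm s i) :=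
  e.isProbabilityMeasure_arm s i

instance : IsProbabilityMeasure e.tableLaw := by
  unfold tableLaw; infer_instance

theorem integrable_id_arm (s : Fin 2) (i : Fin k) : Integrable (fun x => x) (e.arm s i) := by
  refine Integrable.of_bound measurable_id.aestronglyMeasurable 1 ?_
  filter_upwards [e.arm_support s i] with x hx
  rw [Real.norm_eq_abs, abs_le]
  constructor <;> linarith [hx.1, hx.2]

theorem measurePreserving_reward (t : Fin T) (i : Fin k) :
    MeasurePreserving (fun g : RewardTable k T => g t i) e.tableLaw (e.arm (e.epoch t) i) :=
  (measurePreserving_eval (fun i => e.arm (e.epoch t) i) i).comp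
    (measurePreserving_eval (fun t => Measure.pi fun i => e.arm (e.epoch t) i) t)

theorem integrable_reward (t : Fin T) (i : Fin k) :
    Integrable (fun g : RewardTable k T => g t i) e.tableLaw :=
  (e.measurePreserving_reward t i).integrable_comp_of_integrable (e.integrable_id_arm _ i)

theorem integral_reward (t : Fin T) (i : Fin k) :
    ∫ g : RewardTable k T, g t i ∂e.tableLaw = e.mean (e.epoch t) i := by
  rw [mean, ← (e.measurePreserving_reward t i).map_eq]
  exact (integral_map (e.measurePreserving_reward t i).measurable.aemeasurable
    measurable_id.aestronglyMeasurable).symm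

theorem ae_mem_Icc : ∀ᵐ g ∂e.tableLaw, ∀ t i, g t i ∈ Set.Icc (0 : ℝ) 1 := by
  rw [ae_all_iff]; intro t
  rw [ae_all_iff]; intro i
  exact (e.measurePreserving_reward t i).quasiMeasurePreserving.ae (e.arm_support _ i)

/-- A quantity which does not depend on the rewards of round `t` is independent of them. -/
theorem integral_mul_reward (t : Fin T) (i : Fin k) {f : RewardTable k T → ℝ}
    (hf : Measurable f) (hft : ∀ g x, f (Function.update g t x) = f g) :
    ∫ g, f g * g t i ∂e.tableLaw = (∫ g, f g ∂e.tableLaw) * e.mean (e.epoch t) i := by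
  classical
  have hind : ProbabilityTheory.iIndepFun (fun (s : Fin T) (g : RewardTable k T) => g s)
      e.tableLaw :=
    ProbabilityTheory.iIndepFun_pi (X := fun _ x => x) fun _ => aemeasurable_id
  have h := hind.indepFun_finset (Finset.univ.erase t) {t} (by simp)
    (fun s => measurable_pi_apply s)
  -- `f` factors through the rows other than `t`: row `t` may be filled with `0` by `hft`.
  let F : ({s // s ∈ Finset.univ.erase t} → Fin k → ℝ) → ℝ := fun r =>
    f fun s => if hs : s ∈ Finset.univ.erase t then r ⟨s, hs⟩ else 0
  have hF : Measurable F := by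
    refine hf.comp (measurable_pi_lambda _ fun s => ?_)
    by_cases hs : s ∈ Finset.univ.erase t
    · simp only [hs, dite_true]; exact measurable_pi_apply _
    · simp only [hs, dite_false]; exact measurable_const
  let G : (({t} : Finset (Fin T)) → Fin k → ℝ) → ℝ := fun r =>
    r ⟨t, Finset.mem_singleton_self t⟩ i
  have hG : Measurable G := (measurable_pi_apply i).comp (measurable_pi_apply _)
  have h' := h.comp hF hG
  have hFf : (F ∘ fun (g : RewardTable k T) (s : {s // s ∈ Finset.univ.erase t}) => g s)
      = f := by
    ext g
    rw [← hft g 0]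
    simp only [F, Function.comp]
    congr 1
    ext s : 1
    by_cases hs : s = t <;> simp [hs, Function.update]
  rw [hFf] at h'
  rw [← e.integral_reward t i]
  exact h'.integral_fun_mul_eq_mul_integral hf.aestronglyMeasurable
    (e.measurePreserving_reward t i).measurable.aestronglyMeasurable

variable {e}

theorem integrable_of_finite_range {ι : Type*} [Finite ι] [MeasurableSpace ι]
    [MeasurableSingletonClass ι] {a : RewardTable k T → ι} (ha : Measurable a) (f : ι → ℝ) :
    Integrable (fun g => f (a g)) e.tableLaw := by
  obtain ⟨b, hb⟩ := (Set.finite_range fun i => ‖f i‖).bddAbove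
  refine Integrable.of_bound ((measurable_of_countable f).comp ha).aestronglyMeasurable b ?_
  exact .of_forall fun g => hb ⟨a g, rfl⟩

variable (e)

theorem integrable_reward_action (alg : StandardBanditAlgorithm.{u} k T) (ω : alg.Seed)
    (t : Fin T) : Integrable (fun g => g t (alg.action ω g t)) e.tableLaw := by
  have hm : Measurable fun g => alg.action ω g t :=
    (measurable_action alg t).comp measurable_prodMk_left
  refine Integrable.of_bound
    (measurable_apply_index (measurable_pi_apply t) hm).aestronglyMeasurable 1 ?_
  filter_upwards [e.ae_mem_Icc] with g hg
  rw [Real.norm_eq_abs, abs_le]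
  constructor <;> linarith [(hg t (alg.action ω g t)).1, (hg t (alg.action ω g t)).2]

/-- The expected reward in round `t` is the expected mean of the chosen action. -/
theorem integral_reward_action (alg : StandardBanditAlgorithm.{u} k T) (ω : alg.Seed)
    (t : Fin T) : ∫ g, g t (alg.action ω g t) ∂e.tableLaw =
      ∫ g, e.mean (e.epoch t) (alg.action ω g t) ∂e.tableLaw := by
  have hm : Measurable fun g => alg.action ω g t :=
    (measurable_action alg t).comp measurable_prodMk_left
  -- Splitting by the chosen action leaves products of an indicator, fixed by earlier rounds, and a
  -- reward of round `t`; these are independent.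
  let f : Fin k → Fin k → ℝ := fun i j => if j = i then 1 else 0
  have hf : ∀ i, Measurable fun g => f i (alg.action ω g t) := fun i =>
    (measurable_of_countable (f i)).comp hm
  have hfi : ∀ i, Integrable (fun g => f i (alg.action ω g t)) e.tableLaw := fun i =>
    integrable_of_finite_range hm (f i)
  have h1 : ∀ g : RewardTable k T,
      g t (alg.action ω g t) = ∑ i, f i (alg.action ω g t) * g t i := by
    intro g; simp [f]
  have h2 : ∀ g : RewardTable k T, e.mean (e.epoch t) (alg.action ω g t) =
      ∑ i, f i (alg.action ω g t) * e.mean (e.epoch t) i := by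
    intro g; simp [f]
  simp_rw [h1, h2]
  rw [integral_finsetSum, integral_finsetSum]
  · refine Finset.sum_congr rfl fun i _ => ?_
    rw [integral_mul_const]
    refine e.integral_mul_reward t i (hf i) fun g x => ?_
    congr 1
    refine (action_congr alg ω t fun s hs => ?_).symm
    rw [Function.update_of_ne hs.ne]
  · exact fun i _ => (hfi i).mul_const _
  · intro i _
    refine (e.integrable_reward t i).bdd_mul (c := 1) (hf i).aestronglyMeasurable
      (.of_forall fun g => ?_)
    simp only [f]; split_ifs <;> simp

end Environment

/-! ### Regret: boundedness, comparison with means, averaging over seeds -/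

theorem abs_twoSegmentReward_le {k T : ℕ} {g : RewardTable k T}
    (hg : ∀ t i, g t i ∈ Set.Icc (0 : ℝ) 1) (m : ℕ) (i j : Fin k) :
    |twoSegmentReward g m i j| ≤ T := by
  refine (Finset.abs_sum_le_sum_abs _ _).trans ((Finset.sum_le_card_nsmul _ _ 1 ?_).trans ?_)
  · intro t _
    split_ifs <;> rw [abs_le] <;> constructor <;>
      linarith [(hg t i).1, (hg t i).2, (hg t j).1, (hg t j).2]
  · simp

theorem measurable_twoSegmentReward {k T : ℕ} (m : ℕ) (i j : Fin k) :
    Measurable fun g : RewardTable k T => twoSegmentReward g m i j := by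
  refine Finset.measurable_sum _ fun t _ => ?_
  split_ifs
  · exact (measurable_pi_apply i).comp (measurable_pi_apply t)
  · exact (measurable_pi_apply j).comp (measurable_pi_apply t)

theorem twoSegmentReward_le_iSup {k T : ℕ} (g : RewardTable k T) {m : ℕ} (hm : m ≤ T)
    (i j : Fin k) : twoSegmentReward g m i j ≤
      ⨆ c : Fin (T + 1) × Fin k × Fin k, twoSegmentReward g c.1 c.2.1 c.2.2 :=
  le_ciSup (f := fun c : Fin (T + 1) × Fin k × Fin k => twoSegmentReward g c.1 c.2.1 c.2.2)
    (Set.finite_range _).bddAbove (⟨m, Nat.lt_succ_of_le hm⟩, i, j)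

theorem measurable_regret {k T : ℕ} (alg : StandardBanditAlgorithm.{u} k T) :
    Measurable fun p : alg.Seed × RewardTable k T => regret p.2 (alg.action p.1 p.2) := by
  refine Measurable.sub ?_ (Finset.measurable_sum _ fun t _ => ?_)
  · exact Measurable.iSup fun c => (measurable_twoSegmentReward _ _ _).comp measurable_snd
  · exact measurable_apply_index ((measurable_pi_apply t).comp measurable_snd)
      (measurable_action alg t)

theorem abs_regret_le {k T : ℕ} (hk : 0 < k) {g : RewardTable k T}
    (hg : ∀ t i, g t i ∈ Set.Icc (0 : ℝ) 1) (a : Fin T → Fin k) : |regret g a| ≤ 2 * T := by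
  have : Nonempty (Fin k) := ⟨⟨0, hk⟩⟩
  have h1 : |⨆ c : Fin (T + 1) × Fin k × Fin k, twoSegmentReward g c.1 c.2.1 c.2.2| ≤ T := by
    rw [abs_le]
    constructor
    · exact (abs_le.1 (abs_twoSegmentReward_le hg 0 ⟨0, hk⟩ ⟨0, hk⟩)).1.trans
        (twoSegmentReward_le_iSup g (Nat.zero_le T) _ _)
    · exact ciSup_le fun c => (abs_le.1 (abs_twoSegmentReward_le hg _ _ _)).2
  have h2 : |∑ t, g t (a t)| ≤ T := by
    refine (Finset.abs_sum_le_sum_abs _ _).trans ((Finset.sum_le_card_nsmul _ _ 1 ?_).trans ?_)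
    · intro t _
      rw [abs_le]; constructor <;> linarith [(hg t (a t)).1, (hg t (a t)).2]
    · simp
  unfold regret
  rw [abs_le] at *
  constructor <;> linarith

namespace Environment

variable {k T : ℕ} (e : Environment k T) (alg : StandardBanditAlgorithm.{u} k T) (ω : alg.Seed)

theorem integrable_regret (hk : 0 < k) :
    Integrable (fun g => regret g (alg.action ω g)) e.tableLaw := by
  refine Integrable.of_bound
    ((measurable_regret alg).comp measurable_prodMk_left).aestronglyMeasurable (2 * T) ?_
  filter_upwards [e.ae_mem_Icc] with g hg
  exact abs_regret_le hk hg _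

/-- The expected regret is at least the expected gap in means to any two-segment sequence. -/
theorem integral_sum_mean_sub_le (hk : 0 < k) {m : ℕ} (hm : m ≤ T) (i j : Fin k) :
    ∫ g, ∑ t : Fin T, (e.mean (e.epoch t) (if (t : ℕ) < m then i else j) -
      e.mean (e.epoch t) (alg.action ω g t)) ∂e.tableLaw ≤
      ∫ g, regret g (alg.action ω g) ∂e.tableLaw := by
  have hm' : ∀ t, Measurable fun g => alg.action ω g t := fun t =>
    (measurable_action alg t).comp measurable_prodMk_left
  have hi : ∀ t, Integrable (fun g => g t (if (t : ℕ) < m then i else j) -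
      g t (alg.action ω g t)) e.tableLaw := fun t =>
    (e.integrable_reward t _).sub (e.integrable_reward_action alg ω t)
  calc _ = ∫ g, ∑ t : Fin T, (g t (if (t : ℕ) < m then i else j) -
      g t (alg.action ω g t)) ∂e.tableLaw := by
        rw [integral_finsetSum _ fun t _ => hi t, integral_finsetSum]
        · refine Finset.sum_congr rfl fun t _ => ?_
          rw [integral_sub (e.integrable_reward t _) (e.integrable_reward_action alg ω t),
            integral_sub (integrable_const _)
              (integrable_of_finite_range (hm' t) (e.mean (e.epoch t))),
            e.integral_reward, e.integral_reward_action, integral_const]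
          simp
        · exact fun t _ => (integrable_const _).sub
            (integrable_of_finite_range (hm' t) (e.mean (e.epoch t)))
    _ ≤ _ := by
        refine integral_mono (integrable_finsetSum _ fun t _ => hi t)
          (e.integrable_regret alg ω hk) fun g => ?_
        -- The best sequence in hindsight is at least as good as the fixed comparator.
        have := twoSegmentReward_le_iSup g hm i j
        simp only [regret, Finset.sum_sub_distrib]
        refine sub_le_sub_right (le_trans (le_of_eq ?_) this) _
        exact Finset.sum_congr rfl fun t _ => apply_ite _ _ _ _

end Environment

/-- A lower bound for each seed on the regret averaged over the environments is a lower bound on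
the expected regret. -/
theorem le_expectedRegret {k T : ℕ} (hk : 0 < k) (A : RandomAssignment k T)
    (alg : StandardBanditAlgorithm.{u} k T) {c : ℝ}
    (h : ∀ ω, c ≤ ∑ θ, (A.prior θ).toReal *
      ∫ g, regret g (alg.action ω g) ∂(A.env θ).tableLaw) :
    c ≤ expectedRegret A alg := by
  have hprior : ∀ θ, A.prior θ ≠ ⊤ := fun θ => A.prior.apply_ne_top θ
  have : IsFiniteMeasure A.tableLaw := by
    refine ⟨?_⟩
    simp only [RandomAssignment.tableLaw, Measure.coe_finsetSum, Finset.sum_apply,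
      Measure.smul_apply, measure_univ, smul_eq_mul, mul_one]
    exact ENNReal.sum_lt_top.2 fun θ _ => (hprior θ).lt_top
  have hae : ∀ᵐ g ∂A.tableLaw, ∀ t i, g t i ∈ Set.Icc (0 : ℝ) 1 := by
    rw [RandomAssignment.tableLaw, ae_finsetSum_measure_iff]
    exact fun θ _ => Measure.ae_smul_measure (A.env θ).ae_mem_Icc _
  have hint : Integrable (fun p : alg.Seed × RewardTable k T =>
      regret p.2 (alg.action p.1 p.2)) (alg.seedLaw.prod A.tableLaw) := by
    refine Integrable.of_bound (measurable_regret alg).aestronglyMeasurable (2 * T) ?_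
    filter_upwards [Measure.quasiMeasurePreserving_snd.ae hae] with p hp
    exact abs_regret_le hk hp _
  rw [expectedRegret, integral_prod _ hint]
  have hc : c = ∫ _ω : alg.Seed, c ∂alg.seedLaw := by simp
  rw [hc]
  refine integral_mono (integrable_const _) hint.integral_prod_left fun ω => ?_
  refine (h ω).trans (le_of_eq ?_)
  simp only [RandomAssignment.tableLaw]
  rw [integral_finsetSum_measure]
  · exact Finset.sum_congr rfl fun θ _ => by rw [integral_smul_measure, smul_eq_mul]
  · exact fun θ _ => ((A.env θ).integrable_regret alg ω hk).smul_measure (hprior θ)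

/-! ### The Bernoulli environments -/

/-- The Bernoulli distribution with success probability `p`, as a measure on `ℝ`. -/
noncomputable def bernoulliLaw (p : ℝ) : Measure ℝ :=
  ENNReal.ofReal (1 - p) • Measure.dirac 0 + ENNReal.ofReal p • Measure.dirac 1

theorem isProbabilityMeasure_bernoulliLaw {p : ℝ} (h0 : 0 ≤ p) (h1 : p ≤ 1) :
    IsProbabilityMeasure (bernoulliLaw p) := by
  refine ⟨?_⟩
  simp only [bernoulliLaw, Measure.add_apply, Measure.smul_apply, measure_univ, smul_eq_mul,
    mul_one]
  rw [← ENNReal.ofReal_add (by linarith) h0]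
  simp

theorem bernoulliLaw_support (p : ℝ) : ∀ᵐ x ∂bernoulliLaw p, x ∈ Set.Icc (0 : ℝ) 1 := by
  rw [bernoulliLaw, ae_add_measure_iff]
  constructor <;> refine Measure.ae_smul_measure ?_ _ <;>
    exact (ae_dirac_iff (p := fun x => x ∈ Set.Icc (0 : ℝ) 1) measurableSet_Icc).2 (by simp)

theorem integral_bernoulliLaw {p : ℝ} (h0 : 0 ≤ p) : ∫ x, x ∂bernoulliLaw p = p := by
  rw [bernoulliLaw, integral_add_measure, integral_smul_measure, integral_smul_measure]
  · simp [h0]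
  · exact (integrable_dirac (by simp)).smul_measure ENNReal.ofReal_ne_top
  · exact (integrable_dirac (by simp)).smul_measure ENNReal.ofReal_ne_top

/-- Means of the arms: action `0` has mean `1 / 2` and the others `3 / 10`, except that the
improved action, if there is one, has mean `7 / 10`. -/
noncomputable def armMean {n : ℕ} (b : Option (Fin (n + 1))) (i : Fin (n + 2)) : ℝ :=
  if b.map Fin.succ = some i then 7 / 10 else if i = 0 then 1 / 2 else 3 / 10

theorem armMean_mem {n : ℕ} (b : Option (Fin (n + 1))) (i : Fin (n + 2)) :
    armMean b i ∈ Set.Icc (0 : ℝ) 1 := by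
  unfold armMean
  split_ifs <;> norm_num

theorem armMean_none_zero {n : ℕ} : armMean (none : Option (Fin (n + 1))) 0 = 1 / 2 := by
  simp [armMean]

theorem armMean_none_of_ne {n : ℕ} {i : Fin (n + 2)} (hi : i ≠ 0) :
    armMean (none : Option (Fin (n + 1))) i = 3 / 10 := by
  simp [armMean, hi]

theorem armMean_some_succ {n : ℕ} (b : Fin (n + 1)) : armMean (some b) b.succ = 7 / 10 := by
  simp [armMean]

theorem armMean_some_of_ne {n : ℕ} {b : Fin (n + 1)} {i : Fin (n + 2)} (hi : i ≠ b.succ) :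
    armMean (some b) i = armMean none i := by
  simp [armMean, hi.symm]

theorem armMean_none_le {n : ℕ} (i : Fin (n + 2)) :
    armMean (none : Option (Fin (n + 1))) i ≤ 1 / 2 := by
  by_cases hi : i = 0
  · rw [hi, armMean_none_zero]
  · rw [armMean_none_of_ne hi]; norm_num

theorem exists_armMean_gap {n : ℕ} (b : Option (Fin (n + 1))) :
    ∃ i, ∀ j ≠ i, armMean b j + 1 / 5 ≤ armMean b i := by
  cases b with
  | none =>
    refine ⟨0, fun j hj => ?_⟩
    rw [armMean_none_zero, armMean_none_of_ne hj]; norm_num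
  | some b =>
    refine ⟨b.succ, fun j hj => ?_⟩
    rw [armMean_some_succ, armMean_some_of_ne hj]
    linarith [armMean_none_le j]

/-- Bernoulli rewards such that action `0` is good before the switch, and afterwards `b` is
improved. -/
noncomputable def bernoulliEnv {n T : ℕ} (s : ℕ) (h1 : 1 ≤ s) (hT : s ≤ T)
    (b : Option (Fin (n + 1))) : Environment (n + 2) T where
  switch := s
  one_le_switch := h1
  switch_le := hT
  arm r i := bernoulliLaw (armMean (if r = 0 then none else b) i)
  isProbabilityMeasure_arm _ _ :=
    isProbabilityMeasure_bernoulliLaw (armMean_mem _ _).1 (armMean_mem _ _).2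
  arm_support _ _ := bernoulliLaw_support _

section BernoulliEnv

variable {n T s : ℕ} (h1 : 1 ≤ s) (hT : s ≤ T)

theorem mean_bernoulliEnv (b : Option (Fin (n + 1))) (r : Fin 2) (i : Fin (n + 2)) :
    (bernoulliEnv s h1 hT b).mean r i = armMean (if r = 0 then none else b) i :=
  integral_bernoulliLaw (armMean_mem _ _).1

theorem isGood_bernoulliEnv (b : Option (Fin (n + 1))) (r : Fin 2) :
    ∃ G : Finset (Fin (n + 2)), G.card = 1 ∧ (bernoulliEnv s h1 hT b).IsGood r G (1 / 5) := by
  obtain ⟨i, hi⟩ := exists_armMean_gap (if r = 0 then none else b)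
  refine ⟨{i}, Finset.card_singleton i, fun i' hi' j hj => ?_⟩
  rw [Finset.mem_singleton] at hi' hj
  rw [mean_bernoulliEnv, mean_bernoulliEnv, hi']
  exact hi j hj

theorem mean_epoch_bernoulliEnv (b : Option (Fin (n + 1))) (t : Fin T) (i : Fin (n + 2)) :
    (bernoulliEnv s h1 hT b).mean ((bernoulliEnv s h1 hT b).epoch t) i =
      armMean (if (t : ℕ) < s then none else b) i := by
  rw [mean_bernoulliEnv]
  congr 1
  simp only [Environment.epoch, bernoulliEnv]
  by_cases h : (t : ℕ) < s <;> simp [h]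

end BernoulliEnv

/-! ### Indistinguishability of environments -/

/-- The table with the rewards at the entries in `P` replaced by `0`. -/
noncomputable def hideEntries {k T : ℕ} (P : Fin T → Fin k → Prop) (g : RewardTable k T) :
    RewardTable k T := by
  classical exact fun t i => if P t i then 0 else g t i

theorem measurable_hideEntries {k T : ℕ} (P : Fin T → Fin k → Prop) :
    Measurable (hideEntries P) := by
  classical
  refine measurable_pi_lambda _ fun t => measurable_pi_lambda _ fun i => ?_
  unfold hideEntries
  by_cases h : P t i
  · simp [h]
  · simp only [h, if_false]
    exact (measurable_pi_apply i).comp (measurable_pi_apply t)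

/-- Hiding acts entry by entry, so it maps a product law to the product of the images; a hidden
entry becomes the point mass at `0`, whatever its law was. -/
theorem map_hideEntries_tableLaw {k T : ℕ} (P : Fin T → Fin k → Prop) {e e' : Environment k T}
    (h : ∀ t i, ¬ P t i → e.arm (e.epoch t) i = e'.arm (e'.epoch t) i) :
    e.tableLaw.map (hideEntries P) = e'.tableLaw.map (hideEntries P) := by
  classical
  let f : Fin T → Fin k → ℝ → ℝ := fun t i x => if P t i then 0 else x
  have hf : ∀ t i, Measurable (f t i) := fun t i => by
    by_cases h : P t i
    · simp [f, h]
    · simp only [f, h, if_false]; exact measurable_id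
  have key : ∀ e : Environment k T, e.tableLaw.map (hideEntries P) =
      Measure.pi fun t => Measure.pi fun i => (e.arm (e.epoch t) i).map (f t i) := by
    intro e
    have : ∀ t i, IsProbabilityMeasure ((e.arm (e.epoch t) i).map (f t i)) := fun t i =>
      Measure.isProbabilityMeasure_map (hf t i).aemeasurable
    have hrow : ∀ t, (Measure.pi fun i => e.arm (e.epoch t) i).map (fun x i => f t i (x i)) =
        Measure.pi fun i => (e.arm (e.epoch t) i).map (f t i) := fun t =>
      Measure.pi_map_pi fun i => (hf t i).aemeasurable
    have hrow' : ∀ t, IsProbabilityMeasure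
        ((Measure.pi fun i => e.arm (e.epoch t) i).map (fun x i => f t i (x i))) := fun t => by
      rw [hrow]; infer_instance
    simp_rw [← hrow]
    refine Measure.pi_map_pi (f := fun t (x : Fin k → ℝ) i => f t i (x i))
      fun t => Measurable.aemeasurable ?_
    exact measurable_pi_lambda _ fun i => (hf t i).comp (measurable_pi_apply i)
  rw [key, key]
  congr 1; ext1 t; congr 1; ext1 i
  by_cases hP : P t i
  · have hc : f t i = fun _ => 0 := by ext x; simp [f, hP]
    rw [hc, Measure.map_const, Measure.map_const]
    simp
  · rw [h t i hP]

/-- The indicator of the event that the action `i` is not chosen in the `B` rounds after the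
first `s` ones. -/
noncomputable def avoids {k T : ℕ} (s B : ℕ) (i : Fin k) (a : Fin T → Fin k) : ℝ :=
  if ∀ t : Fin T, s ≤ t → (t : ℕ) < s + B → a t ≠ i then 1 else 0

section Regret

variable {k T : ℕ} (alg : StandardBanditAlgorithm.{u} k T) (ω : alg.Seed)

theorem measurable_action_seed : Measurable fun g => alg.action ω g :=
  measurable_pi_lambda _ fun t => (measurable_action alg t).comp measurable_prodMk_left

/-- Until the action `i` is chosen after round `s`, its rewards after round `s` have no influence
on the actions. -/
theorem action_ne_of_agree {s u : ℕ} {i : Fin k} {g g' : RewardTable k T}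
    (hg : ∀ (t : Fin T) j, ¬ (s ≤ (t : ℕ) ∧ j = i) → g t j = g' t j)
    (h : ∀ t : Fin T, s ≤ t → (t : ℕ) < u → alg.action ω g t ≠ i) :
    ∀ t : Fin T, s ≤ t → (t : ℕ) < u → alg.action ω g' t ≠ i := by
  intro t hst htu
  -- The tables could yield different rewards only at a choice of `i` in some round `r` with `s ≤ r
  -- < t`, which `h` excludes.
  rw [← action_congr alg ω t fun r hr => hg r _ fun hri =>
    h r hri.1 (lt_trans (Fin.lt_def.1 hr) htu) hri.2]
  exact h t hst htu

theorem avoids_hideEntries (s B : ℕ) (i : Fin k) (g : RewardTable k T) :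
    avoids s B i (alg.action ω (hideEntries (fun t j => s ≤ (t : ℕ) ∧ j = i) g)) =
      avoids s B i (alg.action ω g) := by
  have hg : ∀ (t : Fin T) j, ¬ (s ≤ (t : ℕ) ∧ j = i) →
      hideEntries (fun t j => s ≤ (t : ℕ) ∧ j = i) g t j = g t j := fun t j h => by
    simp only [hideEntries, if_neg h]
  unfold avoids
  congr 1
  exact propext ⟨action_ne_of_agree alg ω hg,
    action_ne_of_agree alg ω fun t j h => (hg t j h).symm⟩

/-- Avoidance is unaffected by hiding the rewards of `i` from round `s` on, and the hidden tables
have equal laws. This replaces any information-theoretic estimate by an exact identity. -/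
theorem integral_avoids_eq (s B : ℕ) (i : Fin k) {e e' : Environment k T}
    (h : ∀ (t : Fin T) j, ¬ (s ≤ (t : ℕ) ∧ j = i) →
      e.arm (e.epoch t) j = e'.arm (e'.epoch t) j) :
    ∫ g, avoids s B i (alg.action ω g) ∂e.tableLaw =
      ∫ g, avoids s B i (alg.action ω g) ∂e'.tableLaw := by
  have key : ∀ e : Environment k T, ∫ g, avoids s B i (alg.action ω g) ∂e.tableLaw =
      ∫ g, avoids s B i (alg.action ω g)
        ∂(e.tableLaw.map (hideEntries fun t j => s ≤ (t : ℕ) ∧ j = i)) := by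
    intro e
    rw [integral_map (measurable_hideEntries _).aemeasurable]
    · simp_rw [avoids_hideEntries]
    · exact ((measurable_of_countable (avoids s B i)).comp
        (measurable_action_seed alg ω)).aestronglyMeasurable
  rw [key, key, map_hideEntries_tableLaw _ h]

end Regret

/-! ### Cost of exploring and cost of missing the improvement -/

section BernoulliRegret

variable {n T : ℕ} (alg : StandardBanditAlgorithm.{u} (n + 2) T) (ω : alg.Seed)

/-- Without an improved action, every choice of an action other than `0` costs `1 / 5`. -/
theorem regret_bernoulliEnv_none {s : ℕ} (h1 : 1 ≤ s) (hT : s ≤ T) :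
    1 / 5 * ∫ g, ((Finset.univ.filter fun t => alg.action ω g t ≠ 0).card : ℝ)
        ∂(bernoulliEnv (n := n) s h1 hT none).tableLaw ≤
      ∫ g, regret g (alg.action ω g) ∂(bernoulliEnv (n := n) s h1 hT none).tableLaw := by
  refine le_trans (le_of_eq ?_) (Environment.integral_sum_mean_sub_le _ alg ω (by omega)
    (Nat.zero_le T) 0 0)
  rw [← integral_const_mul]
  congr 1
  ext g
  rw [Finset.card_filter, Nat.cast_sum, Finset.mul_sum]
  refine Finset.sum_congr rfl fun t _ => ?_
  simp only [mean_epoch_bernoulliEnv, ite_self, armMean_none_zero]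
  by_cases h : alg.action ω g t = 0
  · simp [h, armMean_none_zero]
  · rw [armMean_none_of_ne h]; simp [h]; norm_num

/-- If `b` is improved after `s` rounds and not chosen in the next `B` rounds, then this costs
`B / 5`; moreover this happens as often as in the environment without improved action. -/
theorem regret_bernoulliEnv_some {s s' B : ℕ} (h1 : 1 ≤ s) (hT : s ≤ T) (h1' : 1 ≤ s')
    (hT' : s' ≤ T) (hB : s + B ≤ T) (b : Fin (n + 1)) :
    B / 5 * ∫ g, avoids s B b.succ (alg.action ω g)
        ∂(bernoulliEnv (n := n) s' h1' hT' none).tableLaw ≤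
      ∫ g, regret g (alg.action ω g) ∂(bernoulliEnv s h1 hT (some b)).tableLaw := by
  rw [← integral_avoids_eq alg ω s B b.succ (e := bernoulliEnv s h1 hT (some b))]
  swap
  · intro t j h
    have hmean : armMean (if (t : ℕ) < s then none else some b) j = armMean none j := by
      split_ifs with hts
      · rfl
      · exact armMean_some_of_ne fun hj => h ⟨not_lt.1 hts, hj⟩
    simp only [bernoulliEnv, Environment.epoch]
    congr 1
    rw [ite_self, ← hmean]
    by_cases hts : (t : ℕ) < s <;> simp [hts]
  -- This comparator plays the good action of each epoch, so no round contributes negatively and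
  -- rounds outside the block can be dropped.
  refine le_trans ?_ (Environment.integral_sum_mean_sub_le _ alg ω (by omega) hT 0 b.succ)
  rw [← integral_const_mul]
  refine integral_mono ?_ ?_ fun g => ?_
  · exact Environment.integrable_of_finite_range (measurable_action_seed alg ω)
      fun a => B / 5 * avoids s B b.succ a
  · exact Environment.integrable_of_finite_range (measurable_action_seed alg ω)
      fun a => ∑ t : Fin T, ((bernoulliEnv s h1 hT (some b)).mean
        ((bernoulliEnv s h1 hT (some b)).epoch t) (if (t : ℕ) < s then 0 else b.succ) -
        (bernoulliEnv s h1 hT (some b)).mean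
          ((bernoulliEnv s h1 hT (some b)).epoch t) (a t))
  · simp only [mean_epoch_bernoulliEnv]
    set a := alg.action ω g
    have hnonneg : ∀ t : Fin T, 0 ≤ armMean (if (t : ℕ) < s then none else some b)
        (if (t : ℕ) < s then 0 else b.succ) -
        armMean (if (t : ℕ) < s then none else some b) (a t) := by
      intro t
      split_ifs with h
      · rw [armMean_none_zero]; linarith [armMean_none_le (a t)]
      · rw [armMean_some_succ]
        by_cases hb : a t = b.succ
        · rw [hb, armMean_some_succ, sub_self]
        · rw [armMean_some_of_ne hb]; linarith [armMean_none_le (a t)]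
    unfold avoids
    split_ifs with hav
    · let S : Finset (Fin T) := Finset.univ.filter fun t => s ≤ (t : ℕ) ∧ (t : ℕ) < s + B
      have hS : S.card = B := by
        have : S.map Fin.valEmbedding = Finset.Ico s (s + B) := by
          ext x
          simp only [S, Finset.mem_map, Finset.mem_filter, Finset.mem_univ, true_and,
            Fin.valEmbedding_apply, Finset.mem_Ico]
          exact ⟨fun ⟨t, ht, hx⟩ => hx ▸ ht, fun hx => ⟨⟨x, by omega⟩, hx, rfl⟩⟩
        rw [← Finset.card_map Fin.valEmbedding, this, Nat.card_Ico]
        omega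
      calc (B : ℝ) / 5 * 1 = ∑ _t ∈ S, (1 / 5 : ℝ) := by
            rw [Finset.sum_const, hS, nsmul_eq_mul]; ring
        _ ≤ ∑ t ∈ S, _ := Finset.sum_le_sum fun t ht => by
            obtain ⟨hst, htB⟩ := (Finset.mem_filter.1 ht).2
            rw [if_neg (not_lt.2 hst), if_neg (not_lt.2 hst), armMean_some_succ,
              armMean_some_of_ne (hav t hst htB)]
            linarith [armMean_none_le (a t)]
        _ ≤ _ := Finset.sum_le_sum_of_subset_of_nonneg (Finset.subset_univ S)
            fun t _ _ => hnonneg t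
    · rw [mul_zero]
      exact Finset.sum_nonneg fun t _ => hnonneg t

end BernoulliRegret

/-! ### Counting over blocks and choice of parameters -/

/-- Every choice of an action other than `0` spoils only one pair of a block and an action. -/
theorem sum_avoids_ge {n T : ℕ} (M B : ℕ) (a : Fin T → Fin (n + 2)) :
    (M : ℝ) * (n + 1) - ((Finset.univ.filter fun t => a t ≠ 0).card : ℝ) ≤
      ∑ p : Fin M × Fin (n + 1), avoids ((p.1 : ℕ) * B + 1) B p.2.succ a := by
  classical
  let Q : Fin M × Fin (n + 1) → Prop := fun p => ∀ t : Fin T,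
    (p.1 : ℕ) * B + 1 ≤ t → (t : ℕ) < (p.1 : ℕ) * B + 1 + B → a t ≠ p.2.succ
  let f : Fin M × Fin (n + 1) → ℕ × Fin (n + 2) := fun p => (p.1, p.2.succ)
  have hf : Function.Injective f := by
    rintro ⟨j, i⟩ ⟨j', i'⟩ h
    simp only [f, Prod.mk.injEq, Fin.succ_inj] at h
    exact Prod.ext (Fin.ext h.1) h.2
  -- The pair is recovered from the spoiling round. The shift by one appears because blocks start at
  -- index `1`: the first epoch must be nonempty.
  have hsub : ((Finset.univ.filter fun p => ¬ Q p).image f) ⊆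
      (Finset.univ.filter fun t => a t ≠ 0).image fun t : Fin T => (((t : ℕ) - 1) / B, a t) := by
    intro x hx
    obtain ⟨p, hp, rfl⟩ := Finset.mem_image.1 hx
    have hp' := (Finset.mem_filter.1 hp).2
    simp only [Q, not_forall, not_not] at hp'
    obtain ⟨t, ht1, ht2, hta⟩ := hp'
    refine Finset.mem_image.2 ⟨t, Finset.mem_filter.2 ⟨Finset.mem_univ t, ?_⟩, ?_⟩
    · rw [hta]; exact Fin.succ_ne_zero _
    · refine Prod.ext ?_ hta
      change ((t : ℕ) - 1) / B = (p.1 : ℕ)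
      refine Nat.div_eq_of_lt_le (by omega) ?_
      rw [Nat.add_mul]; omega
  have hle : (Finset.univ.filter fun p => ¬ Q p).card ≤
      (Finset.univ.filter fun t => a t ≠ 0).card := by
    rw [← Finset.card_image_of_injective _ hf]
    exact (Finset.card_le_card hsub).trans Finset.card_image_le
  have hsum : ∑ p : Fin M × Fin (n + 1), avoids ((p.1 : ℕ) * B + 1) B p.2.succ a =
      ((Finset.univ.filter fun p => Q p).card : ℝ) := by
    rw [Finset.card_filter, Nat.cast_sum]
    refine Finset.sum_congr rfl fun p _ => ?_
    simp only [avoids, Q, Nat.cast_ite, Nat.cast_one, Nat.cast_zero]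
  have hcard : (Finset.univ.filter fun p => Q p).card +
      (Finset.univ.filter fun p => ¬ Q p).card = M * (n + 1) := by
    rw [Finset.card_filter_add_card_filter_not]; simp
  have hcard' : ((Finset.univ.filter fun p => Q p).card : ℝ) +
      ((Finset.univ.filter fun p => ¬ Q p).card : ℝ) = M * (n + 1) := by exact_mod_cast hcard
  have hle' : ((Finset.univ.filter fun p => ¬ Q p).card : ℝ) ≤
      ((Finset.univ.filter fun t => a t ≠ 0).card : ℝ) := by exact_mod_cast hle
  rw [hsum]
  linarith

theorem block_le {T M B : ℕ} (h : M * B + 1 ≤ T) (j : Fin M) : (j : ℕ) * B + 1 + B ≤ T := by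
  have : ((j : ℕ) + 1) * B ≤ M * B := Nat.mul_le_mul_right B j.2
  rw [Nat.add_mul] at this
  omega

/-- With probability `1 / 2` no action is ever improved; otherwise a uniformly random action is
improved at the beginning of a uniformly random one of `M` blocks of `B` rounds. -/
noncomputable def blockAssignment (n : ℕ) {T M B : ℕ} (hM : 0 < M) (h : M * B + 1 ≤ T) :
    RandomAssignment (n + 2) T where
  Param := Bool × Fin M × Fin (n + 1)
  fintypeParam := inferInstance
  prior :=
    have : Nonempty (Fin M) := ⟨⟨0, hM⟩⟩
    PMF.uniformOfFintype _
  env θ := if θ.1 then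
      bernoulliEnv ((θ.2.1 : ℕ) * B + 1) (by omega)
        ((Nat.le_add_right _ B).trans (block_le h θ.2.1)) (some θ.2.2)
    else bernoulliEnv T (by omega) le_rfl none

/-- Exploration lowers the bound from the improved environments by at most what it adds in the
unchanged one; `hB` is the condition for this balance. -/
theorem expectedRegret_blockAssignment {n T M B : ℕ} (hM : 0 < M) (h : M * B + 1 ≤ T)
    (hB : B ≤ M * (n + 1)) (alg : StandardBanditAlgorithm.{u} (n + 2) T) :
    (B : ℝ) / 10 ≤ expectedRegret (blockAssignment n hM h) alg := by
  refine le_expectedRegret (by omega) _ alg fun ω => ?_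
  have h1 : 1 ≤ T := by omega
  have hM' : (0 : ℝ) < M * (n + 1) := by positivity
  have hB' : (B : ℝ) ≤ M * (n + 1) := by exact_mod_cast hB
  have hprior : ∀ θ, ((blockAssignment n hM h).prior θ).toReal = 1 / (2 * (M * (n + 1))) := by
    intro θ
    have : Nonempty (Fin M) := ⟨⟨0, hM⟩⟩
    refine (congrArg ENNReal.toReal
      (PMF.uniformOfFintype_apply (α := Bool × Fin M × Fin (n + 1)) θ)).trans ?_
    rw [ENNReal.toReal_inv, ENNReal.toReal_natCast]
    simp
  set μ := (bernoulliEnv (n := n) T h1 le_rfl none).tableLaw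
  set N := ∫ g, ((Finset.univ.filter fun t => alg.action ω g t ≠ 0).card : ℝ) ∂μ
  have hN : 0 ≤ N := integral_nonneg fun g => Nat.cast_nonneg _
  have hbase := regret_bernoulliEnv_none alg ω h1 le_rfl
  have hav : (M : ℝ) * (n + 1) - N ≤ ∑ p : Fin M × Fin (n + 1),
      ∫ g, avoids ((p.1 : ℕ) * B + 1) B p.2.succ (alg.action ω g) ∂μ := by
    have hm := measurable_action_seed alg ω
    have hi1 := Environment.integrable_of_finite_range
      (e := bernoulliEnv (n := n) T h1 le_rfl none) hm
      fun a => ((Finset.univ.filter fun t => a t ≠ 0).card : ℝ)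
    have hi2 : ∀ p : Fin M × Fin (n + 1), _ := fun p => Environment.integrable_of_finite_range
      (e := bernoulliEnv (n := n) T h1 le_rfl none) hm (avoids ((p.1 : ℕ) * B + 1) B p.2.succ)
    rw [← integral_finsetSum _ fun p _ => hi2 p]
    have hc : (M : ℝ) * (n + 1) - N = ∫ g, ((M : ℝ) * (n + 1) -
        ((Finset.univ.filter fun t => alg.action ω g t ≠ 0).card : ℝ)) ∂μ := by
      rw [integral_sub (integrable_const _) hi1]; simp [N, μ]
    rw [hc]
    exact integral_mono ((integrable_const _).sub hi1) (integrable_finsetSum _ fun p _ => hi2 p)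
      fun g => sum_avoids_ge M B _
  have hblock : (B : ℝ) / 5 * (M * (n + 1) - N) ≤ ∑ p : Fin M × Fin (n + 1),
      ∫ g, regret g (alg.action ω g) ∂((blockAssignment n hM h).env (true, p)).tableLaw := by
    refine (mul_le_mul_of_nonneg_left hav (by positivity)).trans ?_
    rw [Finset.mul_sum]
    exact Finset.sum_le_sum fun p _ =>
      regret_bernoulliEnv_some alg ω _ _ h1 le_rfl (block_le h p.1) p.2
  have hsum : ∑ θ, ((blockAssignment n hM h).prior θ).toReal *
      ∫ g, regret g (alg.action ω g) ∂((blockAssignment n hM h).env θ).tableLaw =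
      1 / (2 * (M * (n + 1))) * (∑ p : Fin M × Fin (n + 1),
        ∫ g, regret g (alg.action ω g) ∂((blockAssignment n hM h).env (true, p)).tableLaw) +
      1 / 2 * ∫ g, regret g (alg.action ω g) ∂μ := by
    simp_rw [hprior]
    rw [← Finset.mul_sum]
    have hsplit : ∀ f : Bool × Fin M × Fin (n + 1) → ℝ,
        ∑ θ, f θ = ∑ p, f (true, p) + ∑ p, f (false, p) := fun f => by
      rw [Fintype.sum_prod_type, Fintype.sum_bool]
    -- The block and action are drawn but ignored here, so these `M * (n + 1)` parameters together
    -- give `μ` weight 1/2.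
    have hfalse : ∀ p, ((blockAssignment n hM h).env (false, p)).tableLaw = μ := fun p => rfl
    refine (congrArg _ (hsplit _)).trans ?_
    simp_rw [hfalse]
    rw [Finset.sum_const, mul_add]
    congr 1
    simp only [Finset.card_univ, Fintype.card_prod, Fintype.card_fin, nsmul_eq_mul,
      Nat.cast_mul, Nat.cast_add, Nat.cast_one]
    field_simp
  rw [hsum]
  have hfinal : (B : ℝ) / 10 ≤ 1 / (2 * (M * (n + 1))) * (B / 5 * (M * (n + 1) - N)) +
      1 / 2 * (1 / 5 * N) := by
    have : 1 / (2 * (M * (n + 1))) * (B / 5 * (M * (n + 1) - N)) + 1 / 2 * (1 / 5 * N) -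
        (B : ℝ) / 10 = N * (M * (n + 1) - B) / (10 * (M * (n + 1))) := by
      field_simp; ring
    have h2 : 0 ≤ N * (M * (n + 1) - B) / (10 * (M * (n + 1))) :=
      div_nonneg (mul_nonneg hN (by linarith)) (by positivity)
    linarith
  refine hfinal.trans (add_le_add ?_ ?_)
  · exact mul_le_mul_of_nonneg_left hblock (by positivity)
  · exact mul_le_mul_of_nonneg_left hbase (by positivity)

/-- A block length of the order of `√((n + 1) T)` suits `blockAssignment`. -/
theorem exists_blocks {n T : ℕ} (hT : 1000 * ((n : ℝ) + 2) ≤ T) :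
    ∃ M B : ℕ, 0 < M ∧ M * B + 1 ≤ T ∧ B ≤ M * (n + 1) ∧
      0.007 * Real.sqrt (((n : ℝ) + 1) * T) ≤ (B : ℝ) / 10 := by
  set R := Real.sqrt (((n : ℝ) + 1) * T) with hR
  have hn : (0 : ℝ) ≤ n := Nat.cast_nonneg n
  have hT0 : (0 : ℝ) ≤ T := Nat.cast_nonneg T
  have hRR : R * R = (n + 1) * T := Real.mul_self_sqrt (by positivity)
  -- Makes the loss from rounding harmless: `B > R / 4 - 1 ≥ R / 8`, hence `B / 10 ≥ R / 80 ≥ 0.007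
  -- * R`.
  have hR8 : 8 ≤ R := Real.le_sqrt_of_sq_le (by nlinarith)
  have hRT : R ≤ T := Real.sqrt_le_iff.2 ⟨hT0, by nlinarith⟩
  have hBle : (⌊R / 4⌋₊ : ℝ) ≤ R / 4 := Nat.floor_le (by positivity)
  have hBlt : R / 4 < ⌊R / 4⌋₊ + 1 := Nat.lt_floor_add_one _
  set B := ⌊R / 4⌋₊
  have hBpos : 0 < B := by
    have : (0 : ℝ) < B := by linarith
    exact_mod_cast this
  have hdm : (T - 1) / B * B + (T - 1) % B = T - 1 := Nat.div_add_mod' _ _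
  have hmod : (T - 1) % B < B := Nat.mod_lt _ hBpos
  have hT1 : 1 ≤ T := by
    have : (1 : ℝ) ≤ T := by linarith
    exact_mod_cast this
  -- As many blocks as fit after the first round, so fewer than `B` of the other rounds are left
  -- over.
  set M := (T - 1) / B
  have hMB : T ≤ M * B + B := by omega
  have hMB' : (T : ℝ) ≤ M * B + B := by exact_mod_cast hMB
  refine ⟨M, B, ?_, by omega, ?_, by linarith⟩
  · rcases Nat.eq_zero_or_pos M with h | h
    · rw [h] at hMB'
      have h4 : (T : ℝ) ≤ T / 4 := by
        calc (T : ℝ) ≤ ((0 : ℕ) : ℝ) * B + B := hMB'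
          _ ≤ T / 4 := by push_cast; linarith
      linarith
    · exact h
  · have hBpos' : (0 : ℝ) < B := by exact_mod_cast hBpos
    -- `B² ≤ (n + 1) * T / 16`, while `M * B ≥ T - B ≥ 3 * T / 4`; comparing and cancelling one
    -- factor `B` gives the claim.
    have h1 : (B : ℝ) * B ≤ R / 4 * (R / 4) := mul_self_le_mul_self hBpos'.le hBle
    have h2 : (n + 1) * (T / 4 : ℝ) ≤ (n + 1) * (M * B) :=
      mul_le_mul_of_nonneg_left (by linarith) (by positivity)
    have h3 : (B : ℝ) * B ≤ M * (n + 1) * B := by nlinarith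
    have h4 : (B : ℝ) ≤ M * (n + 1) := le_of_mul_le_mul_right h3 hBpos'
    exact_mod_cast h4

theorem isGood_blockAssignment {n T M B : ℕ} (hM : 0 < M) (h : M * B + 1 ≤ T)
    (θ : (blockAssignment n hM h).Param) (s : Fin 2) :
    ∃ G : Finset (Fin (n + 2)),
      G.card = 1 ∧ ((blockAssignment n hM h).env θ).IsGood s G (1 / 5) := by
  obtain ⟨c, p⟩ := θ
  cases c
  · exact isGood_bernoulliEnv _ _ _ _
  · exact isGood_bernoulliEnv _ _ _ _

end SwitchingBandit

theorem theorem5 :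
    ∃ C : ℝ, 0 < C ∧ ∀ k T : ℕ, 1 < k → C * (k : ℝ) ≤ (T : ℝ) →
      ∃ A : SwitchingBandit.RandomAssignment k T,
        (∀ θ : A.Param, ∀ s : Fin 2, ∃ G : Finset (Fin k),
          G.card = 1 ∧ (A.env θ).IsGood s G (1 / 5)) ∧
        ∀ alg : SwitchingBandit.StandardBanditAlgorithm.{u} k T,
          0.007 * Real.sqrt (((k : ℝ) - 1) * (T : ℝ)) ≤ SwitchingBandit.expectedRegret A alg := by
  -- The constant is generous: `exists_blocks` needs only `√((k - 1) * T) ≥ 8` and `k - 1 ≤ T`.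
  refine ⟨1000, by norm_num, fun k T hk hT => ?_⟩
  obtain ⟨n, rfl⟩ : ∃ n, k = n + 2 := ⟨k - 2, by omega⟩
  push_cast at hT ⊢
  obtain ⟨M, B, hM, hMB, hB, hc⟩ := SwitchingBandit.exists_blocks hT
  refine ⟨SwitchingBandit.blockAssignment n hM hMB,
    SwitchingBandit.isGood_blockAssignment hM hMB, fun alg => ?_⟩
  have hn : (n : ℝ) + 2 - 1 = n + 1 := by ring
  rw [hn]
  exact hc.trans (SwitchingBandit.expectedRegret_blockAssignment hM hMB hB alg)
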